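/- Let $(X,S)$ be a pair of random variables with $X\in\mathbb R^d$ and $S\in[0,1]$, let $\sigma>0$, and let $X^\sigma = X+\sigma Z$ with $Z\sim\mathcal N(0,I_d)$ independent of $(X,S)$. Let $\mathcal H$ be a set of (Borel measurable) functions $\mathbb R^d\to[0,1]$, put $$\mathrm{MMSE}^{\mathcal H}(S\mid X^\sigma)=\min_{h\in\mathcal H}\mathbb E\big[(S-h(X^\sigma))^2\big],$$ where the minimum is assumed to be attained, and let $h^*_{\mathcal H}\in\mathcal H$ be a minimizer. Let $(X^\sigma_1,S_1),\dots,(X^\sigma_n,S_n)$ be i.i.d. copies of $(X^\sigma,S)$, let $W_i=(S_i-h^*_{\mathcal H}(X^\sigma_i))^2$, and define $$\epsilon_C=\frac1n\sum_{i=1}^n W_i-\mathrm{MMSE}^{\mathcal H}(S\mid X^\sigma).$$ Let $\delta\in(0,1)$. Then each of the following holds. (i) If $n\ge 1$, then with probability at least $1-\delta$, $$\epsilon_C\le\sqrt{\frac{\log(1/\delta)}{2n}}.$$ (ii) If $n\ge 2$, then with probability at least $1-\delta$, $$\epsilon_C\le\sqrt{\frac{2\,\mathrm{Var}_n(W)\log(2/\delta)}{n}}+\frac{7\log(2/\delta)}{3(n-1)},\qquad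 \mathrm{Var}_n(W)=\frac1{n(n-1)}\sum_{1\le i<j\le n}(W_i-W_j)^2 .$$ -/

import Mathlib

open MeasureTheory ProbabilityTheory

noncomputable section

namespace MMSEBound

/-- The additive Gaussian mechanism: the sanitized feature `X^σ = X + σ Z`. -/
def sanitized {Ω : Type*} {d : ℕ} (σ : ℝ) (X Z : Ω → EuclideanSpace ℝ (Fin d)) :
    Ω → EuclideanSpace ℝ (Fin d) :=
  fun ω => X ω + σ • Z ω

/-- The population mean squared error `E[(S - h(Y))²]` of a predictor `h` of `S` from `Y`. -/
def mse {Ω E : Type*} [MeasurableSpace Ω] (P : Measure Ω) (S : Ω → ℝ) (Y : Ω → E)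
    (h : E → ℝ) : ℝ :=
  ∫ ω, (S ω - h (Y ω)) ^ 2 ∂P

/-- The minimum mean squared error of estimating `S` from `Y`, restricted to predictors in the
hypothesis class `H`. -/
def restrictedMMSE {Ω E : Type*} [MeasurableSpace Ω] (P : Measure Ω) (S : Ω → ℝ) (Y : Ω → E)
    (H : Set (E → ℝ)) : ℝ :=
  sInf (mse P S Y '' H)

/-- `h` attains the restricted minimum mean squared error: it belongs to `H` and minimizes
`E[(S - h(Y))²]` over `H`. -/
def IsOptimal {Ω E : Type*} [MeasurableSpace Ω] (P : Measure Ω) (S : Ω → ℝ) (Y : Ω → E)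
    (H : Set (E → ℝ)) (h : E → ℝ) : Prop :=
  h ∈ H ∧ IsMinOn (mse P S Y) H h

/-- The squared error `(s - h(y))²` of `h` on the data point `(y, s)`. -/
def sqErr {E : Type*} (h : E → ℝ) (z : E × ℝ) : ℝ :=
  (z.2 - h z.1) ^ 2

/-- The empirical mean squared error of `h` on a dataset of `n` points `(y_i, s_i)`. -/
def empMSE {E : Type*} {n : ℕ} (D : Fin n → E × ℝ) (h : E → ℝ) : ℝ :=
  (1 / (n : ℝ)) * ∑ i, sqErr h (D i)

/-- The finite-sample error `ε_C = MSE_train(h) - MMSE^H(S | Y)`, where the training set is `D`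
and `h` is to be a predictor attaining the restricted minimum. -/
def epsC {Ω E : Type*} [MeasurableSpace Ω] (P : Measure Ω) (S : Ω → ℝ) (Y : Ω → E)
    (H : Set (E → ℝ)) (h : E → ℝ) {n : ℕ} (D : Fin n → E × ℝ) : ℝ :=
  empMSE D h - restrictedMMSE P S Y H

/-- The sample variance `1 / (n (n - 1)) ∑_{i < j} (w_i - w_j)²`. -/
def sampleVar {n : ℕ} (w : Fin n → ℝ) : ℝ :=
  (1 / ((n : ℝ) * ((n : ℝ) - 1))) * ∑ i, ∑ j ∈ Finset.Ioi i, (w i - w j) ^ 2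

end MMSEBound

end

/-! The predictor `hstar` is fixed before the sample is drawn, so the losses `W i` are i.i.d. in
[0,1], and optimality makes their mean the restricted MMSE. Both claims are therefore tail bounds
for a sample mean; (i) is Hoeffding's inequality.

For (ii), write L = log(2/δ) and let V be the variance of `W i`. Outside an event of probability
δ/2, Bernstein's inequality (`measureReal_bernstein`) gives the radius √(2VL/n) + L/(3n). To replace
V by the sample variance, `measureReal_sqrt_sampleVar_add_le` shows that √V exceeds the sample
standard deviation by at least √(2L/(n-1)) with probability at most δ/2. A union bound and
`bernstein_radius_le` finish.

The lower tail uses Hoeffding's device for U-statistics: the sample variance is an average over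
permutations of means of independent terms (w - w')²/2 on disjoint pairs. Convexity of exp transfers
the moment generating function bound of one such mean to the average. -/

namespace MMSEBound

/-! ### Elementary bounds on the exponential -/

lemma exp_neg_le_quadratic {x : ℝ} (hx : 0 ≤ x) : Real.exp (-x) ≤ 1 - x + x ^ 2 / 2 := by
  have h := Real.quadratic_le_exp_of_nonneg hx
  rw [Real.exp_neg, inv_le_iff_one_le_mul₀ (Real.exp_pos x)]
  have h0 : 0 ≤ 1 - x + x ^ 2 / 2 := by nlinarith [sq_nonneg (x - 1)]
  -- (1 - x + x²/2)(1 + x + x²/2) = 1 + x⁴/4 ≥ 1.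
  nlinarith [mul_le_mul_of_nonneg_left h h0, sq_nonneg (x ^ 2)]

/-- The `(2, 1)` Padé approximant bounds the exponential from above on `[0, 3)`. -/
lemma exp_mul_le_pade {z : ℝ} (hz : 0 ≤ z) :
    Real.exp z * (6 - 2 * z) ≤ 6 + 4 * z + z ^ 2 := by
  -- The difference of the two sides and its derivative both vanish at 0; the second derivative is
  -- nonnegative because 1 - x ≤ exp (-x).
  have h1 : ∀ x : ℝ, HasDerivAt (fun y => 4 + 2 * y - Real.exp y * (4 - 2 * y))
      (2 - Real.exp x * (2 - 2 * x)) x := fun x => by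
    have := (((hasDerivAt_id x).const_mul 2).const_add 4).sub
      ((Real.hasDerivAt_exp x).mul (((hasDerivAt_id x).const_mul 2).const_sub 4))
    refine this.congr_deriv ?_
    simp only [id]; ring
  have h0 : ∀ x : ℝ, HasDerivAt (fun y => 6 + 4 * y + y ^ 2 - Real.exp y * (6 - 2 * y))
      (4 + 2 * x - Real.exp x * (4 - 2 * x)) x := fun x => by
    have := ((((hasDerivAt_id x).const_mul 4).const_add 6).add ((hasDerivAt_id x).pow 2)).sub
      ((Real.hasDerivAt_exp x).mul (((hasDerivAt_id x).const_mul 2).const_sub 6))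
    refine this.congr_deriv ?_
    simp only [id]; ring
  have m1 : Monotone (fun y => 4 + 2 * y - Real.exp y * (4 - 2 * y)) := by
    refine monotone_of_deriv_nonneg (fun x => (h1 x).differentiableAt) fun x => ?_
    rw [(h1 x).deriv]
    have h := Real.add_one_le_exp (-x)
    have h' := mul_le_mul_of_nonneg_left h (Real.exp_pos x).le
    rw [← Real.exp_add, add_neg_cancel, Real.exp_zero] at h'
    nlinarith
  have m0 : MonotoneOn (fun y => 6 + 4 * y + y ^ 2 - Real.exp y * (6 - 2 * y)) (Set.Ici 0) := by
    refine monotoneOn_of_deriv_nonneg (convex_Ici 0)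
      (fun x _ => (h0 x).continuousAt.continuousWithinAt)
      (fun x _ => (h0 x).differentiableAt.differentiableWithinAt) fun x hx => ?_
    rw [interior_Ici] at hx
    rw [(h0 x).deriv]
    have := m1 (le_of_lt (Set.mem_Ioi.1 hx))
    simpa using this
  have := m0 (Set.self_mem_Ici) hz hz
  simp only [Real.exp_zero] at this
  linarith

/-- The source of the 1/3 in Bernstein's inequality. For z ≤ 0 the quadratic bound is already
stronger; for z ≥ 0 the case b = z is the Padé bound, and the right side increases with b. -/
lemma exp_le_of_le {z b : ℝ} (hzb : z ≤ b) (hb0 : 0 ≤ b) (hb : b < 3) :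
    Real.exp z ≤ 1 + z + z ^ 2 / (2 * (1 - b / 3)) := by
  have hb' : 0 < 2 * (1 - b / 3) := by linarith
  rcases le_total z 0 with hz | hz
  · have h := exp_neg_le_quadratic (neg_nonneg.2 hz)
    rw [neg_neg] at h
    have : z ^ 2 / 2 ≤ z ^ 2 / (2 * (1 - b / 3)) := by
      gcongr; linarith
    nlinarith
  · have hz' : 0 < 2 * (1 - z / 3) := by linarith
    have : z ^ 2 / (2 * (1 - z / 3)) ≤ z ^ 2 / (2 * (1 - b / 3)) := by gcongr
    refine le_trans ?_ (add_le_add_right this _)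
    have h := exp_mul_le_pade hz
    have e : 1 + z + z ^ 2 / (2 * (1 - z / 3)) = (6 + 4 * z + z ^ 2) / (6 - 2 * z) := by
      have h6 : 6 - 2 * z ≠ 0 := by linarith
      rw [show 2 * (1 - z / 3) = (6 - 2 * z) / 3 by ring, div_div_eq_mul_div, eq_div_iff h6, add_mul,
        div_mul_cancel₀ _ h6]
      ring
    rw [e, le_div_iff₀ (by linarith)]
    exact h

/-! ### The sample variance as an average over permutations -/

lemma exists_perm_map_pair {α : Type*} [DecidableEq α] {a b x y : α} (hab : a ≠ b) (hxy : x ≠ y) :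
    ∃ τ : Equiv.Perm α, τ a = x ∧ τ b = y := by
  have hb : Equiv.swap a x b ≠ x := fun h => hab ((Equiv.swap a x).injective (by simp [h]))
  refine ⟨(Equiv.swap a x).trans (Equiv.swap (Equiv.swap a x b) y), ?_, ?_⟩
  · simp [Equiv.swap_apply_of_ne_of_ne hb.symm hxy]
  · simp

/-- Averaging a function of two arguments, vanishing on the diagonal, over the images of a fixed
pair under all permutations. -/
lemma sum_perm_pair {α : Type*} [Fintype α] [DecidableEq α] (f : α → α → ℝ) (hf : ∀ i, f i i = 0)
    {a b : α} (hab : a ≠ b) :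
    ((Fintype.card α : ℝ) * (Fintype.card α - 1)) * ∑ p : Equiv.Perm α, f (p a) (p b) =
      (Fintype.card (Equiv.Perm α) : ℝ) * ∑ i, ∑ j, f i j := by
  -- Right multiplication by a permutation sending (a, b) to (x, y) reindexes the sum, so it is the
  -- same for every off-diagonal pair.
  have key : ∀ x y, ∑ p : Equiv.Perm α, f (p x) (p y) =
      (∑ p : Equiv.Perm α, f (p a) (p b)) - if x = y then ∑ p : Equiv.Perm α, f (p a) (p b) else 0 := by
    intro x y
    by_cases h : x = y
    · subst h; simp [hf]
    · obtain ⟨τ, rfl, rfl⟩ := exists_perm_map_pair hab h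
      rw [if_neg h, sub_zero]
      exact Fintype.sum_equiv (Equiv.mulRight τ) _ _ (fun p => by simp)
  have h1 : ∑ x, ∑ y, ∑ p : Equiv.Perm α, f (p x) (p y) =
      (Fintype.card (Equiv.Perm α) : ℝ) * ∑ i, ∑ j, f i j := by
    calc _ = ∑ p : Equiv.Perm α, ∑ x, ∑ y, f (p x) (p y) := by
          rw [Finset.sum_comm (s := (Finset.univ : Finset (Equiv.Perm α)))]
          exact Finset.sum_congr rfl fun x _ => Finset.sum_comm
      _ = ∑ p : Equiv.Perm α, ∑ i, ∑ j, f i j := by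
          refine Finset.sum_congr rfl fun p _ => ?_
          rw [Equiv.sum_comp p (fun i => ∑ y, f i (p y))]
          exact Finset.sum_congr rfl fun i _ => Equiv.sum_comp p (f i)
      _ = _ := by simp
  rw [← h1]
  rw [Finset.sum_congr rfl fun x _ => Finset.sum_congr rfl fun y _ => key x y]
  generalize ∑ p : Equiv.Perm α, f (p a) (p b) = c
  simp [Finset.sum_sub_distrib]
  ring

lemma sampleVar_eq_sum_sum {n : ℕ} (w : Fin n → ℝ) :
    sampleVar w = (1 / ((n : ℝ) * (n - 1))) * ((∑ i, ∑ j, (w i - w j) ^ 2) / 2) := by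
  unfold sampleVar
  congr 1
  rw [eq_div_iff two_ne_zero]
  have h1 : ∀ i, ∑ j ∈ Finset.Ioi i, (w i - w j) ^ 2 = ∑ j, if i < j then (w i - w j) ^ 2 else 0 := by
    intro i
    rw [← Finset.sum_filter]
    congr 1; ext; simp
  simp_rw [h1, mul_two]
  conv_lhs => arg 2; rw [Finset.sum_comm]
  rw [← Finset.sum_add_distrib]
  refine Finset.sum_congr rfl fun i _ => ?_
  rw [← Finset.sum_add_distrib]
  refine Finset.sum_congr rfl fun j _ => ?_
  rcases lt_trichotomy i j with h | h | h
  · simp [h, h.not_gt]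
  · simp [h]
  · simp [h, h.not_gt]; ring

lemma sampleVar_nonneg {n : ℕ} (hn : 2 ≤ n) (w : Fin n → ℝ) : 0 ≤ sampleVar w := by
  have : (2 : ℝ) ≤ n := by exact_mod_cast hn
  have : (0 : ℝ) ≤ n * (n - 1) := by nlinarith
  unfold sampleVar
  positivity

/-- The sample variance is the average over all permutations of the mean half squared distance
over a fixed family of pairs. -/
lemma sampleVar_eq_perm_average {n : ℕ} (hn : 2 ≤ n) {ι : Type*} [Fintype ι] [Nonempty ι]
    (a b : ι → Fin n) (hab : ∀ k, a k ≠ b k) (w : Fin n → ℝ) :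
    sampleVar w = ∑ p : Equiv.Perm (Fin n), (Fintype.card (Equiv.Perm (Fin n)) : ℝ)⁻¹ *
      ((Fintype.card ι : ℝ)⁻¹ * ∑ k, (w (p (a k)) - w (p (b k))) ^ 2 / 2) := by
  have hn2 : (2 : ℝ) ≤ n := by exact_mod_cast hn
  have hn0 : (n : ℝ) ≠ 0 := by linarith
  have hn1 : (n : ℝ) - 1 ≠ 0 := by linarith
  have hm : (Fintype.card ι : ℝ) ≠ 0 := by simp
  have hN : (Fintype.card (Equiv.Perm (Fin n)) : ℝ) ≠ 0 := by simp [Fintype.card_ne_zero]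
  have h : ∀ k, ∑ p : Equiv.Perm (Fin n), (w (p (a k)) - w (p (b k))) ^ 2 / 2 =
      (Fintype.card (Equiv.Perm (Fin n)) : ℝ) * sampleVar w := by
    intro k
    have := sum_perm_pair (fun i j => (w i - w j) ^ 2) (by simp) (hab k)
    rw [Fintype.card_fin] at this
    rw [sampleVar_eq_sum_sum, ← Finset.sum_div]
    field_simp
    linarith
  rw [← Finset.mul_sum, ← Finset.mul_sum, Finset.sum_comm, Finset.sum_congr rfl fun k _ => h k]
  simp only [Finset.sum_const, Finset.card_univ, nsmul_eq_mul]
  field_simp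

end MMSEBound

/-! ### Lower tail of the sample variance -/

namespace MMSEBound

variable {Ω : Type*} [MeasurableSpace Ω] {Q : Measure Ω}

/-- The variable q = (X - Y)²/2 has mean V and lies in [0, 1/2], so q² ≤ q/2. The quadratic term of
exp (-θq) is thus at most θ²q/4, which makes the whole exponent proportional to V. -/
lemma mgf_half_sq_sub_le [IsProbabilityMeasure Q] {X Y : Ω → ℝ} (hX : AEMeasurable X Q)
    (hY : AEMeasurable Y Q) (hX01 : ∀ᵐ ω ∂Q, X ω ∈ Set.Icc (0 : ℝ) 1)
    (hY01 : ∀ᵐ ω ∂Q, Y ω ∈ Set.Icc (0 : ℝ) 1) (hXY : IndepFun X Y Q) {μ V : ℝ}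
    (hXμ : ∫ ω, X ω ∂Q = μ) (hYμ : ∫ ω, Y ω ∂Q = μ) (hXV : Var[X; Q] = V) (hYV : Var[Y; Q] = V)
    {θ : ℝ} (hθ : 0 ≤ θ) :
    mgf (fun ω => (X ω - Y ω) ^ 2 / 2) Q (-θ) ≤ Real.exp (-θ * V + θ ^ 2 * V / 4) := by
  have hX2 : MemLp X 2 Q := memLp_of_bounded hX01 hX.aestronglyMeasurable 2
  have hY2 : MemLp Y 2 Q := memLp_of_bounded hY01 hY.aestronglyMeasurable 2
  have hq : AEMeasurable (fun ω => (X ω - Y ω) ^ 2 / 2) Q := by fun_prop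
  have hqb : ∀ᵐ ω ∂Q, (X ω - Y ω) ^ 2 / 2 ∈ Set.Icc (0 : ℝ) (1 / 2) := by
    filter_upwards [hX01, hY01] with ω h1 h2
    exact ⟨by positivity, by nlinarith [h1.1, h1.2, h2.1, h2.2]⟩
  have hqi : Integrable (fun ω => (X ω - Y ω) ^ 2 / 2) Q := Integrable.of_mem_Icc _ _ hq hqb
  have hmean : ∫ ω, (X ω - Y ω) ^ 2 / 2 ∂Q = V := by
    have h1 : Var[fun ω => X ω - Y ω; Q] = V + V := by
      rw [variance_fun_sub hX2 hY2, hXY.covariance_eq_zero hX2 hY2, hXV, hYV]; ring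
    have h0 : ∫ ω, X ω - Y ω ∂Q = 0 := by
      rw [integral_sub (hX2.integrable one_le_two) (hY2.integrable one_le_two), hXμ, hYμ, sub_self]
    rw [variance_of_integral_eq_zero (by fun_prop) h0] at h1
    rw [integral_div, h1]; ring
  have hle : mgf (fun ω => (X ω - Y ω) ^ 2 / 2) Q (-θ) ≤
      ∫ ω, (1 + (-θ + θ ^ 2 / 4) * ((X ω - Y ω) ^ 2 / 2)) ∂Q := by
    refine integral_mono_ae (integrable_exp_mul_of_mem_Icc hq hqb)
      ((integrable_const _).add (hqi.const_mul _)) ?_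
    filter_upwards [hqb] with ω h
    have h1 := exp_neg_le_quadratic (mul_nonneg hθ h.1)
    rw [← neg_mul] at h1
    refine h1.trans ?_
    have h2 := mul_le_mul_of_nonneg_left h.2 (mul_nonneg (sq_nonneg θ) h.1)
    nlinarith
  rw [integral_add (integrable_const _) (hqi.const_mul _), integral_const_mul, hmean] at hle
  refine hle.trans ?_
  have := Real.add_one_le_exp (-θ * V + θ ^ 2 * V / 4)
  simp only [integral_const, probReal_univ, smul_eq_mul, mul_one]
  linarith

/-- Functions of disjoint pairs of independent variables have multiplicative moment generating
functions. -/
lemma mgf_sum_pairs {κ ι : Type*} {W : κ → Ω → ℝ} (hind : iIndepFun W Q)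
    (hW : ∀ i, AEMeasurable (W i) Q) {F : ℝ → ℝ → ℝ} (hF : Measurable (Function.uncurry F))
    {a b : ι → κ} (ha : Function.Injective a) (hb : Function.Injective b) (hab : ∀ k l, a k ≠ b l)
    (s : Finset ι) (t : ℝ) :
    mgf (fun ω => ∑ k ∈ s, F (W (a k) ω) (W (b k) ω)) Q t =
      ∏ k ∈ s, mgf (fun ω => F (W (a k) ω) (W (b k) ω)) Q t := by
  classical
  have := hind.isProbabilityMeasure
  have hm : ∀ k, AEMeasurable (fun ω => F (W (a k) ω) (W (b k) ω)) Q := fun k =>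
    hF.comp_aemeasurable ((hW _).prodMk (hW _))
  induction s using Finset.induction_on with
  | empty => simp
  | insert k s hk ih =>
    rw [Finset.prod_insert hk, ← ih]
    simp_rw [Finset.sum_insert hk]
    refine IndepFun.mgf_add' (X := fun ω => F (W (a k) ω) (W (b k) ω))
      (Y := fun ω => ∑ k ∈ s, F (W (a k) ω) (W (b k) ω)) ?_ (hm k).aestronglyMeasurable
      (Finset.aemeasurable_fun_sum s fun k _ => hm k).aestronglyMeasurable
    have hdisj : Disjoint ({a k, b k} : Finset κ) (s.image a ∪ s.image b) := by
      rw [Finset.disjoint_left]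
      intro x hx hx'
      simp only [Finset.mem_insert, Finset.mem_singleton, Finset.mem_union, Finset.mem_image] at hx hx'
      rcases hx with rfl | rfl <;> rcases hx' with ⟨l, hl, e⟩ | ⟨l, hl, e⟩
      · exact hk (ha e ▸ hl)
      · exact hab _ _ e.symm
      · exact hab _ _ e
      · exact hk (hb e ▸ hl)
    have h := hind.indepFun_finset₀ _ _ hdisj hW
    have hak : a k ∈ ({a k, b k} : Finset κ) := by simp
    have hbk : b k ∈ ({a k, b k} : Finset κ) := by simp
    have has : ∀ l : s, a l ∈ s.image a ∪ s.image b := fun l =>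
      Finset.mem_union_left _ (Finset.mem_image_of_mem _ l.2)
    have hbs : ∀ l : s, b l ∈ s.image a ∪ s.image b := fun l =>
      Finset.mem_union_right _ (Finset.mem_image_of_mem _ l.2)
    have h' := h.comp
      (φ := fun v : (({a k, b k} : Finset κ) → ℝ) => F (v ⟨a k, hak⟩) (v ⟨b k, hbk⟩))
      (ψ := fun v : ((s.image a ∪ s.image b : Finset κ) → ℝ) =>
        ∑ l : s, F (v ⟨a l, has l⟩) (v ⟨b l, hbs l⟩))
      (hF.comp (f := fun v : (({a k, b k} : Finset κ) → ℝ) => (v ⟨a k, hak⟩, v ⟨b k, hbk⟩))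
        ((measurable_pi_apply _).prodMk (measurable_pi_apply _)))
      (Finset.measurable_sum _ fun l _ =>
        hF.comp (f := fun v : ((s.image a ∪ s.image b : Finset κ) → ℝ) =>
            (v ⟨a l, has l⟩, v ⟨b l, hbs l⟩))
          ((measurable_pi_apply _).prodMk (measurable_pi_apply _)))
    have e : (fun ω => ∑ l ∈ s, F (W (a l) ω) (W (b l) ω)) =
        fun ω => ∑ l : s, F (W (a l) ω) (W (b l) ω) :=
      funext fun ω => (Finset.sum_coe_sort s fun l => F (W (a l) ω) (W (b l) ω)).symm
    rw [e]
    exact h'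

section IndependentSample

variable [IsProbabilityMeasure Q] {n : ℕ} {W : Fin n → Ω → ℝ} {μ V : ℝ}

/-- By Jensen it suffices to bound the mean over m disjoint pairs for each permutation. There the
moment generating function factors into m copies of the one-pair bound at θ = t/m. -/
lemma mgf_sampleVar_le (hind : iIndepFun W Q)
    (hW : ∀ i, AEMeasurable (W i) Q) (hW01 : ∀ i, ∀ᵐ ω ∂Q, W i ω ∈ Set.Icc (0 : ℝ) 1)
    (hμ : ∀ i, ∫ ω, W i ω ∂Q = μ) (hV : ∀ i, Var[W i; Q] = V) (hn : 2 ≤ n) {m : ℕ} (hm : 0 < m)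
    (hmn : 2 * m ≤ n) {t : ℝ} (ht : 0 ≤ t) :
    Integrable (fun ω => Real.exp (-t * sampleVar (fun i => W i ω))) Q ∧
    mgf (fun ω => sampleVar (fun i => W i ω)) Q (-t) ≤
      Real.exp (-t * V + t ^ 2 * V / (4 * m)) := by
  let a : Fin m → Fin n := fun k => ⟨2 * k, by omega⟩
  let b : Fin m → Fin n := fun k => ⟨2 * k + 1, by omega⟩
  have ha : Function.Injective a := fun k l h => by
    simp only [a, Fin.mk.injEq] at h; exact Fin.ext (by omega)
  have hb : Function.Injective b := fun k l h => by
    simp only [b, Fin.mk.injEq] at h; exact Fin.ext (by omega)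
  have hab : ∀ k l, a k ≠ b l := fun k l h => by
    simp only [a, b, Fin.mk.injEq] at h; omega
  have : Nonempty (Fin m) := ⟨⟨0, hm⟩⟩
  have hm' : (m : ℝ) ≠ 0 := by exact_mod_cast hm.ne'
  let u : Equiv.Perm (Fin n) → Ω → ℝ := fun p ω =>
    ∑ k, (W (p (a k)) ω - W (p (b k)) ω) ^ 2 / 2
  have hu : ∀ p, AEMeasurable (u p) Q := fun p => by
    have := hW
    fun_prop
  have hub : ∀ p, ∀ᵐ ω ∂Q, u p ω ∈ Set.Icc (0 : ℝ) m := by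
    intro p
    filter_upwards [ae_all_iff.2 hW01] with ω h
    refine ⟨Finset.sum_nonneg fun k _ => by positivity, ?_⟩
    -- A crude bound suffices: it serves only integrability.
    calc u p ω ≤ ∑ _k : Fin m, (1 : ℝ) := by
          refine Finset.sum_le_sum fun k _ => ?_
          have h1 := h (p (a k)); have h2 := h (p (b k))
          nlinarith [h1.1, h1.2, h2.1, h2.2]
      _ = m := by simp
  have hN0 : (0 : ℝ) < Fintype.card (Equiv.Perm (Fin n)) := by
    exact_mod_cast Fintype.card_pos
  set N : ℝ := (Fintype.card (Equiv.Perm (Fin n)) : ℝ) with hN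
  have hrep : ∀ ω, sampleVar (fun i => W i ω) =
      ∑ p : Equiv.Perm (Fin n), N⁻¹ * ((m : ℝ)⁻¹ * u p ω) := fun ω => by
    rw [sampleVar_eq_perm_average hn a b (fun k => hab k k), Fintype.card_fin]
  have hint : ∀ p, Integrable (fun ω => Real.exp (-(t / m) * u p ω)) Q := fun p =>
    integrable_exp_mul_of_mem_Icc (hu p) (hub p)
  have hjensen : ∀ ω, Real.exp (-t * sampleVar (fun i => W i ω)) ≤
      ∑ p : Equiv.Perm (Fin n), N⁻¹ * Real.exp (-(t / m) * u p ω) := by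
    intro ω
    have := convexOn_exp.map_sum_le (t := (Finset.univ : Finset (Equiv.Perm (Fin n))))
      (w := fun _ => N⁻¹) (p := fun p => -(t / m) * u p ω) (fun _ _ => by positivity)
      (by simp only [Finset.sum_const, Finset.card_univ, nsmul_eq_mul, ← hN]
          exact mul_inv_cancel₀ hN0.ne') (fun _ _ => Set.mem_univ _)
    simp only [smul_eq_mul] at this
    refine le_trans (le_of_eq ?_) this
    rw [hrep, Finset.mul_sum]
    congr 1
    refine Finset.sum_congr rfl fun p _ => ?_
    field_simp
  have hint_sum : Integrable (fun ω =>
      ∑ p : Equiv.Perm (Fin n), N⁻¹ * Real.exp (-(t / m) * u p ω)) Q :=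
    integrable_finsetSum _ fun p _ => (hint p).const_mul _
  have hsm : AEMeasurable (fun ω => sampleVar (fun i => W i ω)) Q := by
    simp_rw [hrep]
    fun_prop
  have hint' : Integrable (fun ω => Real.exp (-t * sampleVar (fun i => W i ω))) Q := by
    refine hint_sum.mono (Real.measurable_exp.comp_aemeasurable
      (hsm.const_mul (-t))).aestronglyMeasurable (Filter.Eventually.of_forall fun ω => ?_)
    rw [Real.norm_of_nonneg (Real.exp_pos _).le]
    exact (hjensen ω).trans (Real.le_norm_self _)
  refine ⟨hint', ?_⟩
  have hp : ∀ p, mgf (u p) Q (-(t / m)) ≤ Real.exp (-t * V + t ^ 2 * V / (4 * m)) := by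
    intro p
    have h1 := mgf_sum_pairs hind hW (F := fun x y => (x - y) ^ 2 / 2)
      (by unfold Function.uncurry; fun_prop)
      (p.injective.comp ha) (p.injective.comp hb) (fun k l h => hab k l (p.injective h))
      Finset.univ (-(t / m))
    have h2 : mgf (u p) Q (-(t / m)) ≤ ∏ _k : Fin m,
        Real.exp (-(t / m) * V + (t / m) ^ 2 * V / 4) := by
      refine h1.le.trans (Finset.prod_le_prod (fun _ _ => mgf_nonneg) fun k _ => ?_)
      exact mgf_half_sq_sub_le (hW _) (hW _) (hW01 _) (hW01 _)
        (hind.indepFun fun h => hab k k (p.injective h)) (hμ _) (hμ _) (hV _) (hV _) (by positivity)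
    refine h2.trans (le_of_eq ?_)
    rw [Finset.prod_const, Finset.card_univ, Fintype.card_fin, ← Real.exp_nat_mul]
    congr 1
    field_simp
  calc mgf (fun ω => sampleVar (fun i => W i ω)) Q (-t)
      ≤ ∫ ω, ∑ p : Equiv.Perm (Fin n), N⁻¹ * Real.exp (-(t / m) * u p ω) ∂Q :=
        integral_mono hint' hint_sum hjensen
    _ = ∑ p : Equiv.Perm (Fin n), N⁻¹ * mgf (u p) Q (-(t / m)) := by
        rw [integral_finsetSum _ fun p _ => (hint p).const_mul _]
        simp_rw [integral_const_mul]
        rfl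
    _ ≤ ∑ _p : Equiv.Perm (Fin n), N⁻¹ * Real.exp (-t * V + t ^ 2 * V / (4 * m)) := by
        gcongr with p
        exact hp p
    _ = _ := by
        rw [Finset.sum_const, Finset.card_univ, nsmul_eq_mul, ← hN, ← mul_assoc,
          mul_inv_cancel₀ hN0.ne', one_mul]

/-- Lower tail of the sample standard deviation. -/
lemma measureReal_sqrt_sampleVar_add_le (hind : iIndepFun W Q)
    (hW : ∀ i, AEMeasurable (W i) Q) (hW01 : ∀ i, ∀ᵐ ω ∂Q, W i ω ∈ Set.Icc (0 : ℝ) 1)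
    (hμ : ∀ i, ∫ ω, W i ω ∂Q = μ) (hV : ∀ i, Var[W i; Q] = V) (hn : 2 ≤ n) {m : ℕ} (hm : 0 < m)
    (hmn : 2 * m ≤ n) {s : ℝ} (hs : 0 < s) :
    Q.real {ω | √(sampleVar (fun i => W i ω)) + s ≤ √V} ≤ Real.exp (-(m * s ^ 2)) := by
  -- For s > √V the event is empty; the remaining case s ≤ √V is what the inclusion `hsub` needs.
  by_cases hsV : √V < s
  · have : {ω | √(sampleVar (fun i => W i ω)) + s ≤ √V} = ∅ := by
      ext ω
      have := Real.sqrt_nonneg (sampleVar (fun i => W i ω))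
      simp only [Set.mem_ofPred_eq, Set.mem_empty_iff_false, iff_false, not_le]
      linarith
    rw [this, measureReal_empty]
    positivity
  push Not at hsV
  have hm0 : (0 : ℝ) < m := by exact_mod_cast hm
  have hv : 0 < √V := hs.trans_le hsV
  have hVpos : 0 < V := Real.sqrt_pos.1 hv
  have hVsq : √V ^ 2 = V := Real.sq_sqrt hVpos.le
  generalize √V = v at *
  subst hVsq
  -- This t minimizes the Chernoff exponent -tsv + t²v²/(4m), with value -ms².
  have ht : 0 ≤ 2 * m * s / v := by positivity
  obtain ⟨hi, hmgf⟩ := mgf_sampleVar_le hind hW hW01 hμ hV hn hm hmn ht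
  -- (v - s)² ≤ v² - sv because s ≤ v.
  have hsub : {ω | √(sampleVar (fun i => W i ω)) + s ≤ v} ⊆
      {ω | sampleVar (fun i => W i ω) ≤ v ^ 2 - s * v} := by
    intro ω h
    simp only [Set.mem_ofPred_eq] at h ⊢
    have h0 := Real.sqrt_nonneg (sampleVar (fun i => W i ω))
    have h1 := Real.sq_sqrt (sampleVar_nonneg hn (fun i => W i ω))
    nlinarith
  refine (measureReal_mono hsub).trans ((measure_le_le_exp_mul_mgf _ (neg_nonpos.2 ht) hi).trans ?_)
  refine (mul_le_mul_of_nonneg_left hmgf (Real.exp_pos _).le).trans (le_of_eq ?_)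
  rw [← Real.exp_add]
  congr 1
  field_simp
  ring

/-! ### Bernstein and Hoeffding inequalities -/

lemma mgf_sub_mean_le {X : Ω → ℝ} (hX : AEMeasurable X Q)
    (hX01 : ∀ᵐ ω ∂Q, X ω ∈ Set.Icc (0 : ℝ) 1) {θ : ℝ} (hθ0 : 0 ≤ θ) (hθ : θ < 3) :
    mgf (fun ω => X ω - ∫ ω, X ω ∂Q) Q θ ≤
      Real.exp (Var[X; Q] * (θ ^ 2 / (2 * (1 - θ / 3)))) := by
  have hXi : Integrable X Q := Integrable.of_mem_Icc _ _ hX hX01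
  have hV := variance_eq_integral (μ := Q) hX
  have hz : ∫ ω, X ω - ∫ ω, X ω ∂Q ∂Q = 0 := by
    rw [integral_sub hXi (integrable_const _)]; simp
  have hμ0 : 0 ≤ ∫ ω, X ω ∂Q :=
    integral_nonneg_of_ae (by filter_upwards [hX01] with ω h using h.1)
  have hμ1 : ∫ ω, X ω ∂Q ≤ 1 := by
    have := integral_mono_ae hXi (integrable_const (1 : ℝ))
      (by filter_upwards [hX01] with ω h using h.2)
    simpa using this
  generalize ∫ ω, X ω ∂Q = μ at *
  have hb : ∀ᵐ ω ∂Q, X ω - μ ∈ Set.Icc (-1 : ℝ) 1 := by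
    filter_upwards [hX01] with ω h
    exact ⟨by linarith [h.1], by linarith [h.2]⟩
  have hYi : Integrable (fun ω => X ω - μ) Q := hXi.sub (integrable_const _)
  have hY2 : Integrable (fun ω => (X ω - μ) ^ 2) Q :=
    (memLp_of_bounded hb (hX.sub_const μ).aestronglyMeasurable 2).integrable_sq
  set C := θ ^ 2 / (2 * (1 - θ / 3)) with hC
  have hle : mgf (fun ω => X ω - μ) Q θ ≤
      ∫ ω, (1 + θ * (X ω - μ) + C * (X ω - μ) ^ 2) ∂Q := by
    refine integral_mono_ae (integrable_exp_mul_of_mem_Icc (hX.sub_const μ) hb)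
      (((integrable_const _).add (hYi.const_mul _)).add (hY2.const_mul _)) ?_
    filter_upwards [hb] with ω h
    -- Since X - μ ≤ 1, the exponent is at most θ.
    refine (exp_le_of_le (b := θ) (by nlinarith [h.2]) hθ0 hθ).trans (le_of_eq ?_)
    rw [hC]; ring
  have hval : ∫ ω, (1 + θ * (X ω - μ) + C * (X ω - μ) ^ 2) ∂Q = 1 + C * Var[X; Q] := by
    rw [integral_add (f := fun ω => 1 + θ * (X ω - μ))
        ((integrable_const _).add (hYi.const_mul _)) (hY2.const_mul _),
      integral_add (integrable_const _) (hYi.const_mul _), integral_const_mul, integral_const_mul,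
      hz, ← hV]
    simp
  rw [hval] at hle
  refine hle.trans ?_
  have := Real.add_one_le_exp (Var[X; Q] * C)
  linarith

/-- **Bernstein's inequality** for independent variables with values in `[0, 1]`. -/
lemma measureReal_bernstein (hind : iIndepFun W Q)
    (hW : ∀ i, AEMeasurable (W i) Q) (hW01 : ∀ i, ∀ᵐ ω ∂Q, W i ω ∈ Set.Icc (0 : ℝ) 1)
    (hμ : ∀ i, ∫ ω, W i ω ∂Q = μ) (hV : ∀ i, Var[W i; Q] = V) (hn : 0 < n) {x : ℝ} (hx : 0 < x) :
    Q.real {ω | n * (√(2 * V * x) + x / 3) ≤ ∑ i, (W i ω - μ)} ≤ Real.exp (-(n * x)) := by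
  have hn0 : (0 : ℝ) < n := by exact_mod_cast hn
  have hV0 : 0 ≤ V := hV ⟨0, hn⟩ ▸ variance_nonneg _ _
  -- Zero variance is separate: the θ chosen below would equal 3, where the moment bound breaks
  -- down. The variables are then almost surely constant.
  rcases hV0.eq_or_lt with rfl | hVpos
  · have hnull : Q {ω | n * (√(2 * 0 * x) + x / 3) ≤ ∑ i, (W i ω - μ)} = 0 := by
      have hc : ∀ i, ∀ᵐ ω ∂Q, W i ω = μ := fun i => by
        have := ae_eq_integral_of_variance_eq_zero
          (memLp_of_bounded (hW01 i) (hW i).aestronglyMeasurable 2) (hV i)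
        rwa [hμ] at this
      refine measure_eq_zero_iff_ae_notMem.2 ?_
      filter_upwards [ae_all_iff.2 hc] with ω h
      simp only [h, not_le, mul_zero, zero_mul, Real.sqrt_zero, sub_self,
        Finset.sum_const_zero, zero_add]
      positivity
    rw [measureReal_def, hnull]
    simpa using (Real.exp_pos _).le
  have ha : 0 < √(2 * x) := by positivity
  have hv : 0 < √V := by positivity
  have hxa : x = √(2 * x) ^ 2 / 2 := by rw [Real.sq_sqrt (by positivity)]; ring
  have hsq : √(2 * V * x) = √V * √(2 * x) := by
    rw [← Real.sqrt_mul hV0]; congr 1; ring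
  have hVsq : V = √V ^ 2 := (Real.sq_sqrt hV0).symm
  rw [hsq]
  generalize √(2 * x) = a at *
  generalize √V = v at *
  have hd : 0 < v + a / 3 := by positivity
  -- With this θ the factor 1 - θ/3 is v/(v + a/3), and the Chernoff exponent per variable collapses
  -- to -a²/2 = -x.
  set θ := a / (v + a / 3) with hθ
  have hθ0 : 0 ≤ θ := by positivity
  have hθ3 : θ < 3 := by
    rw [hθ, div_lt_iff₀ hd]; linarith
  have h1θ : 1 - θ / 3 = v / (v + a / 3) := by
    rw [hθ]; field_simp; ring
  have hmgf : mgf (fun ω => ∑ i, (W i ω - μ)) Q θ ≤ Real.exp (n * (V * (θ ^ 2 / (2 * (1 - θ / 3))))) := by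
    have hi : iIndepFun (fun i ω => W i ω - μ) Q :=
      hind.comp (fun _ y => y - μ) (fun _ => by fun_prop)
    have h := hi.mgf_sum₀ (t := θ) (fun i => (hW i).sub_const μ) Finset.univ
    have e : (∑ i, fun ω => W i ω - μ) = fun ω => ∑ i, (W i ω - μ) := by ext; simp
    rw [e] at h
    rw [h, Real.exp_nat_mul]
    calc _ ≤ ∏ _i : Fin n, Real.exp (V * (θ ^ 2 / (2 * (1 - θ / 3)))) := by
          refine Finset.prod_le_prod (fun _ _ => mgf_nonneg) fun i _ => ?_
          have := mgf_sub_mean_le (hW i) (hW01 i) hθ0 hθ3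
          rwa [hμ, hV] at this
      _ = _ := by simp
  have hint : Integrable (fun ω => Real.exp (θ * ∑ i, (W i ω - μ))) Q := by
    refine integrable_exp_mul_of_mem_Icc (a := ∑ _i : Fin n, (0 - μ)) (b := ∑ _i : Fin n, (1 - μ))
      (by have := hW; fun_prop) ?_
    filter_upwards [ae_all_iff.2 hW01] with ω h
    exact ⟨Finset.sum_le_sum fun i _ => sub_le_sub_right (h i).1 _,
      Finset.sum_le_sum fun i _ => sub_le_sub_right (h i).2 _⟩
  refine (measure_ge_le_exp_mul_mgf _ hθ0 hint).trans ?_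
  refine (mul_le_mul_of_nonneg_left hmgf (Real.exp_pos _).le).trans (le_of_eq ?_)
  rw [← Real.exp_add]
  congr 1
  rw [h1θ, hxa, hVsq, hθ]
  field_simp
  ring

/-- **Hoeffding's inequality** for the mean of independent variables with values in `[0, 1]`. -/
lemma measureReal_hoeffding (hind : iIndepFun W Q)
    (hW : ∀ i, AEMeasurable (W i) Q) (hW01 : ∀ i, ∀ᵐ ω ∂Q, W i ω ∈ Set.Icc (0 : ℝ) 1)
    (hμ : ∀ i, ∫ ω, W i ω ∂Q = μ) (hn : 0 < n) {L : ℝ} (hL : 0 ≤ L) :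
    Q.real {ω | n * √(L / (2 * n)) ≤ ∑ i, (W i ω - μ)} ≤ Real.exp (-L) := by
  have hn0 : (0 : ℝ) < n := by exact_mod_cast hn
  have hi : iIndepFun (fun i ω => W i ω - μ) Q :=
    hind.comp (fun _ y => y - μ) (fun _ => by fun_prop)
  have h := HasSubgaussianMGF.measure_sum_ge_le_of_iIndepFun hi (s := Finset.univ)
    (c := fun _ => (‖(1 : ℝ) - 0‖₊ / 2) ^ 2)
    (fun i _ => by
      have := hasSubgaussianMGF_of_mem_Icc (hW i) (hW01 i)
      rwa [hμ] at this) (ε := n * √(L / (2 * n))) (by positivity)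
  refine h.trans (le_of_eq ?_)
  rw [mul_pow, Real.sq_sqrt (by positivity)]
  simp
  field_simp

end IndependentSample

lemma one_sub_le_measureReal [IsProbabilityMeasure Q] {A B : Set Ω} {δ : ℝ} (hAB : Aᶜ ⊆ B)
    (hB : Q.real B ≤ δ) : 1 - δ ≤ Q.real A := by
  have h1 : Q.real (A ∪ B) = 1 := by
    rw [Set.eq_univ_of_forall (s := A ∪ B) fun ω => or_iff_not_imp_left.2 fun h => hAB h,
      probReal_univ]
  have := measureReal_union_le (μ := Q) A B
  linarith

end MMSEBound
-- From tail bounds to the empirical error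
namespace MMSEBound

lemma empMSE_sub_le_iff {E : Type*} {n : ℕ} (hn : 0 < n) (D : Fin n → E × ℝ) (h : E → ℝ) (μ t : ℝ) :
    empMSE D h - μ ≤ t ↔ ∑ i, (sqErr h (D i) - μ) ≤ n * t := by
  have hn0 : (0 : ℝ) < n := by exact_mod_cast hn
  rw [Finset.sum_sub_distrib, Finset.sum_const, Finset.card_univ, Fintype.card_fin, nsmul_eq_mul,
    ← mul_le_mul_iff_right₀ hn0, empMSE]
  field_simp

lemma IsOptimal.restrictedMMSE_eq {Ω E : Type*} [MeasurableSpace Ω] {P : Measure Ω} {S : Ω → ℝ}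
    {Y : Ω → E} {H : Set (E → ℝ)} {h : E → ℝ} (hopt : IsOptimal P S Y H h) :
    restrictedMMSE P S Y H = mse P S Y h :=
  IsLeast.csInf_eq ⟨Set.mem_image_of_mem _ hopt.1, by
    rintro _ ⟨g, hg, rfl⟩
    exact hopt.2 hg⟩

/-- The Bernstein radius at the population variance is dominated by the empirical one. -/
lemma bernstein_radius_le {n v w L : ℝ} (hn : 2 ≤ n) (hL : 0 < L)
    (hvw : √v ≤ √w + √(2 * L / (n - 1))) :
    √(2 * v * (L / n)) + L / n / 3 ≤ √(2 * w * L / n) + 7 * L / (3 * (n - 1)) := by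
  have hn1 : 0 < n - 1 := by linarith
  have hn0 : 0 < n := by linarith
  have hr : 0 ≤ 2 * L / n := by positivity
  have e1 : √(2 * v * (L / n)) = √(2 * L / n) * √v := by
    rw [← Real.sqrt_mul hr]; congr 1; ring
  have e2 : √(2 * w * L / n) = √(2 * L / n) * √w := by
    rw [← Real.sqrt_mul hr]; congr 1; ring
  have hle : 2 * L / n ≤ 2 * L / (n - 1) := by gcongr; linarith
  have hs : √(2 * L / n) * √(2 * L / (n - 1)) ≤ 2 * L / (n - 1) := by
    calc _ ≤ √(2 * L / (n - 1)) * √(2 * L / (n - 1)) := by gcongr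
      _ = _ := Real.mul_self_sqrt (by positivity)
  -- 7/3 = 2 + 1/3: the 2 absorbs the cross term √(2L/n)·√(2L/(n-1)), the 1/3 the linear Bernstein
  -- term.
  have h3 : 7 * L / (3 * (n - 1)) = 2 * L / (n - 1) + 2 * L / (n - 1) / 6 := by
    field_simp; ring
  have h4 : L / n / 3 = 2 * L / n / 6 := by ring
  rw [e1, e2, h3, h4]
  nlinarith [mul_le_mul_of_nonneg_left hvw (Real.sqrt_nonneg (2 * L / n))]

end MMSEBound

theorem proposition1
    {Ω Ω' : Type*} [MeasurableSpace Ω] [MeasurableSpace Ω']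
    (P : Measure Ω) [IsProbabilityMeasure P] (Q : Measure Ω') [IsProbabilityMeasure Q]
    -- the population: features, sensitive attribute with values in [0,1], Gaussian noise
    {d : ℕ} (X Z : Ω → EuclideanSpace ℝ (Fin d)) (S : Ω → ℝ)
    (hX : Measurable X) (hS : Measurable S) (hS01 : ∀ᵐ ω ∂P, S ω ∈ Set.Icc (0 : ℝ) 1)
    (hZ : HasLaw Z (stdGaussian (EuclideanSpace ℝ (Fin d))) P)
    (hZind : IndepFun Z (fun ω => (X ω, S ω)) P)
    (σ : ℝ) (hσ : 0 < σ)
    -- the hypothesis class and a minimizer of the population error in it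
    (H : Set (EuclideanSpace ℝ (Fin d) → ℝ))
    (hHmeas : ∀ h ∈ H, Measurable h)
    (hH01 : ∀ h ∈ H, ∀ x, h x ∈ Set.Icc (0 : ℝ) 1)
    (hstar : EuclideanSpace ℝ (Fin d) → ℝ)
    (hopt : MMSEBound.IsOptimal P S (MMSEBound.sanitized σ X Z) H hstar)
    -- the training set: n i.i.d. copies of the pair formed by the sanitized feature and S
    (n : ℕ) (D : Fin n → Ω' → EuclideanSpace ℝ (Fin d) × ℝ)
    (hDindep : iIndepFun D Q)
    (hDlaw : ∀ i, IdentDistrib (D i) (fun ω => (MMSEBound.sanitized σ X Z ω, S ω)) Q P)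
    (δ : ℝ) (hδ : δ ∈ Set.Ioo (0 : ℝ) 1) :
    (1 ≤ n →
      1 - δ ≤ Q.real {ω |
        MMSEBound.epsC P S (MMSEBound.sanitized σ X Z) H hstar (fun i => D i ω) ≤
          Real.sqrt (Real.log (1 / δ) / (2 * n))}) ∧
    (2 ≤ n →
      1 - δ ≤ Q.real {ω |
        MMSEBound.epsC P S (MMSEBound.sanitized σ X Z) H hstar (fun i => D i ω) ≤
          Real.sqrt (2 * MMSEBound.sampleVar (fun i => MMSEBound.sqErr hstar (D i ω)) *
              Real.log (2 / δ) / n) +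
            7 * Real.log (2 / δ) / (3 * ((n : ℝ) - 1))}) := by
  obtain ⟨hδ0, hδ1⟩ := hδ
  set Y := MMSEBound.sanitized σ X Z
  have hm : Measurable (MMSEBound.sqErr hstar) := by
    have := hHmeas hstar hopt.1
    unfold MMSEBound.sqErr
    fun_prop
  let W : Fin n → Ω' → ℝ := fun i ω => MMSEBound.sqErr hstar (D i ω)
  let W₀ : Ω → ℝ := fun ω => MMSEBound.sqErr hstar (Y ω, S ω)
  have hid : ∀ i, IdentDistrib (W i) W₀ Q P := fun i => (hDlaw i).comp hm
  have hind : iIndepFun W Q := hDindep.comp (fun _ => MMSEBound.sqErr hstar) fun _ => hm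
  have hW : ∀ i, AEMeasurable (W i) Q := fun i => (hid i).aemeasurable_fst
  have hW01 : ∀ i, ∀ᵐ ω ∂Q, W i ω ∈ Set.Icc (0 : ℝ) 1 := fun i => by
    refine (hid i).symm.ae_mem_snd measurableSet_Icc ?_
    filter_upwards [hS01] with ω hω
    have h := hH01 hstar hopt.1 (Y ω)
    exact ⟨sq_nonneg _, by simp only [W₀, MMSEBound.sqErr]; nlinarith [h.1, h.2, hω.1, hω.2]⟩
  have hμ : ∀ i, ∫ ω, W i ω ∂Q = MMSEBound.restrictedMMSE P S Y H := fun i => by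
    rw [hopt.restrictedMMSE_eq]
    exact (hid i).integral_eq
  have hV : ∀ i, Var[W i; Q] = Var[W₀; P] := fun i => (hid i).variance_eq
  have hL1 : 0 < Real.log (1 / δ) := Real.log_pos (by rw [one_div]; exact (one_lt_inv₀ hδ0).2 hδ1)
  have hL2 : 0 < Real.log (2 / δ) := Real.log_pos (by rw [lt_div_iff₀ hδ0]; linarith)
  have he2 : Real.exp (-Real.log (2 / δ)) = δ / 2 := by
    rw [Real.exp_neg, Real.exp_log (by positivity), inv_div]
  refine ⟨fun hn => ?_, fun hn => ?_⟩
  · have hb := MMSEBound.measureReal_hoeffding hind hW hW01 hμ hn hL1.le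
    rw [Real.exp_neg, Real.exp_log (by positivity), one_div, inv_inv] at hb
    refine MMSEBound.one_sub_le_measureReal (fun ω hω => ?_) (one_div δ ▸ hb)
    by_contra h
    exact hω ((MMSEBound.empMSE_sub_le_iff hn _ _ _ _).2 (not_le.1 h).le)
  · have hn' : (2 : ℝ) ≤ n := by exact_mod_cast hn
    have hn1 : (0 : ℝ) < n - 1 := by linarith
    have hn0 : 0 < n := by omega
    set L := Real.log (2 / δ)
    have hb1 := MMSEBound.measureReal_bernstein hind hW hW01 hμ hV hn0 (x := L / n) (by positivity)
    have hb2 := MMSEBound.measureReal_sqrt_sampleVar_add_le hind hW hW01 hμ hV hn (m := n / 2)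
      (by omega) (by omega) (s := √(2 * L / (n - 1))) (by positivity)
    rw [mul_div_cancel₀ _ (by positivity), he2] at hb1
    -- An odd n leaves one point unpaired, hence n - 1 rather than n in the bound.
    have hhalf : ((n : ℝ) - 1) / 2 ≤ (n / 2 : ℕ) := by
      have : n ≤ 2 * (n / 2) + 1 := by omega
      have : (n : ℝ) ≤ 2 * (n / 2 : ℕ) + 1 := by exact_mod_cast this
      linarith
    have hexp : L ≤ (n / 2 : ℕ) * √(2 * L / (n - 1)) ^ 2 := by
      rw [Real.sq_sqrt (by positivity)]
      calc L = (n - 1) / 2 * (2 * L / (n - 1)) := by field_simp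
        _ ≤ _ := by gcongr
    have hb2' := hb2.trans ((Real.exp_le_exp.2 (neg_le_neg hexp)).trans he2.le)
    refine MMSEBound.one_sub_le_measureReal (fun ω hω => ?_)
      ((measureReal_union_le _ _).trans ((add_le_add hb1 hb2').trans (add_halves δ).le))
    by_contra h
    simp only [Set.mem_union, not_or] at h
    refine hω ((MMSEBound.empMSE_sub_le_iff hn0 _ _ _ _).2 ((not_le.1 h.1).le.trans ?_))
    exact mul_le_mul_of_nonneg_left (MMSEBound.bernstein_radius_le hn'
      hL2 (not_le.1 h.2).le) (by positivity)
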